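/- Let $K$ be an algebraically closed field of characteristic zero and let $Z\subset K^3$ be a rational affine surface, i.e. $Z=\{f=0\}$ for an irreducible polynomial $f\in K[x,y,z]$ (the defining polynomial of $Z$), and $Z$ is the Zariski closure of the image of a (not necessarily proper) rational parametrization $$Q(t,s)=\left(\frac{N_1(t,s)}{D_1(t,s)},\frac{N_2(t,s)}{D_2(t,s)},\frac{N_3(t,s)}{D_3(t,s)}\right)$$ in reduced form. Put $\deg(Z)=\deg(f)$, and for $A=(a,b,c)\in K^3$ let the multiplicity $\operatorname{mult}(A,Z)$ be the least degree of a nonzero homogeneous component of $f(x+a,y+b,z+c)$. When $Z$ is not a plane, $N_1-aD_1$ is not zero, and we put $$\chi_1^A=\frac{N_2-bD_2}{N_1-aD_1}\cdot\frac{D_1}{D_2},\qquad \chi_2^A=\frac{N_3-cD_3}{N_1-aD_1}\cdot\frac{D_1}{D_3}\in K(t,s).$$ Let $h_1,h_2$ be new variables, let $g_i$ be the numerator, in reduced form, of $\chi_i^A(t,s)-\chi_i^A(h_1,h_2)$ for $i=1,2$, and let $\kappa=\gcd(g_1,g_2)$ in $K[h_1,h_2][t,s]$ (all of these being determined up to nonzero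 constant factors). Define $g^{Q,A}=\kappa$ if $\kappa$ has positive degree in the variables $\{t,s\}$, and $g^{Q,A}=1$ otherwise. If $Z$ is not a plane, then there is at most one point $A\in K^3$ with $g^{Q,A}\neq 1$. Likewise, if $Z$ is not a plane, there is at most one point $A\in K^3$ with $\operatorname{mult}(A,Z)=\deg(Z)$. -/

import Mathlib

namespace RationalSurface

open MvPolynomial

/-- The zero set in affine 3-space of a polynomial in three variables. -/
def zeroSet {K : Type*} [Field K] (f : MvPolynomial (Fin 3) K) : Set (Fin 3 → K) :=
  {p | eval p f = 0}

/-- `Z` is an irreducible affine surface with defining polynomial `f`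
(over an algebraically closed field, `f` is determined by `Z` up to a nonzero constant). -/
def IsDefiningPolynomial {K : Type*} [Field K] (f : MvPolynomial (Fin 3) K)
    (Z : Set (Fin 3 → K)) : Prop :=
  Irreducible f ∧ Z = zeroSet f

/-- `Z` is a plane `α x + β y + γ z = δ`, where `(α, β, γ) ≠ 0`. -/
def IsPlane {K : Type*} [Field K] (Z : Set (Fin 3 → K)) : Prop :=
  ∃ (n : Fin 3 → K) (δ : K), n ≠ 0 ∧ Z = {p | n 0 * p 0 + n 1 * p 1 + n 2 * p 2 = δ}

/-- The polynomial `f(x + a, y + b, z + c)`, where `A = (a, b, c)`. -/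
noncomputable def translate {K : Type*} [Field K] (A : Fin 3 → K)
    (f : MvPolynomial (Fin 3) K) : MvPolynomial (Fin 3) K :=
  aeval (fun i => X i + C (A i)) f

/-- The multiplicity of the point `A` on the surface with defining polynomial `f`: the least
degree of a nonzero homogeneous component of `f(x + a, y + b, z + c)`. -/
noncomputable def mult {K : Type*} [Field K] (A : Fin 3 → K)
    (f : MvPolynomial (Fin 3) K) : ℕ :=
  sInf {n | homogeneousComponent n (translate A f) ≠ 0}

/-- The field `K(t, s)` of rational functions; `t`, `s` are the variables `X 0`, `X 1`. -/
abbrev RatFun (K : Type*) [Field K] : Type _ := FractionRing (MvPolynomial (Fin 2) K)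

/-- The polynomial ring `K[h₁, h₂][t, s]`: the outer variables are `t`, `s`, the inner ones
are `h₁`, `h₂`. -/
abbrev PolyTSH (K : Type*) [Field K] : Type _ := MvPolynomial (Fin 2) (MvPolynomial (Fin 2) K)

/-- The points `(N₁/D₁, N₂/D₂, N₃/D₃)(t₀, s₀)` for all `(t₀, s₀)` at which none of the
denominators `Dᵢ` vanishes, where `Nᵢ/Dᵢ` is the reduced form of `Q i`. -/
noncomputable def image {K : Type*} [Field K] (Q : Fin 3 → RatFun K) : Set (Fin 3 → K) :=
  {p | ∃ u : Fin 2 → K, ∀ i,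
    eval u (IsFractionRing.den (MvPolynomial (Fin 2) K) (Q i) : MvPolynomial (Fin 2) K) ≠ 0 ∧
    p i = eval u (IsFractionRing.num (MvPolynomial (Fin 2) K) (Q i)) /
      eval u (IsFractionRing.den (MvPolynomial (Fin 2) K) (Q i) : MvPolynomial (Fin 2) K)}

/-- `Q` is a rational parametrization (not necessarily proper) of `Z`: `Z` is the Zariski
closure of the image of `Q`. -/
def IsParametrization {K : Type*} [Field K] (Q : Fin 3 → RatFun K)
    (Z : Set (Fin 3 → K)) : Prop :=
  Z = zeroLocus K (vanishingIdeal K (image Q))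

/-- The two components
`χ₁ = (N₂ - b D₂) / (N₁ - a D₁) * (D₁ / D₂)` and `χ₂ = (N₃ - c D₃) / (N₁ - a D₁) * (D₁ / D₃)`
of the map `Φ_{2,3}(A)`, where `A = (a, b, c)` and `Q i = Nᵢ / Dᵢ`; in terms of `Q` they are
`(Q₂ - b) / (Q₁ - a)` and `(Q₃ - c) / (Q₁ - a)`. -/
noncomputable def chi {K : Type*} [Field K] (Q : Fin 3 → RatFun K) (A : Fin 3 → K) :
    Fin 2 → RatFun K :=
  ![(Q 1 - algebraMap K (RatFun K) (A 1)) / (Q 0 - algebraMap K (RatFun K) (A 0)),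
    (Q 2 - algebraMap K (RatFun K) (A 2)) / (Q 0 - algebraMap K (RatFun K) (A 0))]

/-- `χ(t, s)`, seen as a rational function of `t, s, h₁, h₂`. -/
noncomputable def inTS (K : Type*) [Field K] : RatFun K →+* FractionRing (PolyTSH K) :=
  IsFractionRing.map (B := PolyTSH K)
    (j := MvPolynomial.map (C : K →+* MvPolynomial (Fin 2) K))
    (map_injective _ (C_injective (Fin 2) K))

/-- `χ(h₁, h₂)`, seen as a rational function of `t, s, h₁, h₂`. -/
noncomputable def inH (K : Type*) [Field K] : RatFun K →+* FractionRing (PolyTSH K) :=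
  IsFractionRing.map (B := PolyTSH K) (j := (C : MvPolynomial (Fin 2) K →+* PolyTSH K))
    (C_injective (Fin 2) (MvPolynomial (Fin 2) K))

/-- The polynomial `gᵢ = numer (χᵢ(t, s) - χᵢ(h₁, h₂))`. -/
noncomputable def gPart {K : Type*} [Field K] (Q : Fin 3 → RatFun K) (A : Fin 3 → K)
    (i : Fin 2) : PolyTSH K :=
  IsFractionRing.num (PolyTSH K) (inTS K (chi Q A i) - inH K (chi Q A i))

/-- A greatest common divisor in `K[h₁, h₂][t, s]` (determined up to a nonzero constant). -/
noncomputable def polyGCD {K : Type*} [Field K] (p q : PolyTSH K) : PolyTSH K :=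
  letI := UniqueFactorizationMonoid.toGCDMonoid (PolyTSH K)
  gcd p q

open Classical in
/-- The polynomial `g^{Q,A}(t, s, h₁, h₂)`: it is `gcd (g₁, g₂)` if this has positive degree
in `t, s`, and `1` otherwise. -/
noncomputable def g {K : Type*} [Field K] (Q : Fin 3 → RatFun K) (A : Fin 3 → K) : PolyTSH K :=
  if 0 < (polyGCD (gPart Q A 0) (gPart Q A 1)).totalDegree then
    polyGCD (gPart Q A 0) (gPart Q A 1)
  else 1

end RationalSurface

/-! Both conditions force `Z` to be a cone with vertex `A`: `f(X + A)` is homogeneous of degree `deg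
f`. An irreducible cone with two vertices is a plane.

Multiplicity `deg f` leaves only one homogeneous component, which settles that case. If `g ≠ 1`,
take a prime `p` of positive degree in `t, s` dividing both `gᵢ`. In the residue field of `p`, the
points `t = (t, s)` and `h = (h₁, h₂)` satisfy `χ(t) = χ(h)`. Were `χ₁, χ₂` algebraically
independent, exchange would make `t` and `s` algebraic over `K(χ(t)) = K(χ(h)) ⊆ K(h)`, so `p` could
involve neither (`not_algebraicIndependent_chi`). A relation between `χ₁` and `χ₂` homogenizes to a
form vanishing at `Q - A`; `f(X + A)` divides it, and factors of forms are forms.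

For two vertices (`isPlane_of_isHomogeneous_translate`), composing the homotheties about each makes
`f` invariant along `v = B - A`. A zero of the form in a plane transverse to `v` then sweeps out a
plane inside `Z`. -/

namespace RationalSurface

open MvPolynomial

/-! ### Homogeneous polynomials and their factors -/

section Homogeneous

variable {σ R : Type*} [CommRing R]

/-- The homomorphism `F(x) ↦ F(T x)`, whose coefficients are the homogeneous components. -/
noncomputable def scaleHom (σ R : Type*) [CommRing R] :
    MvPolynomial σ R →ₐ[R] Polynomial (MvPolynomial σ R) :=
  aeval fun i => Polynomial.C (X i) * Polynomial.X

lemma scaleHom_monomial (m : σ →₀ ℕ) (a : R) :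
    scaleHom σ R (monomial m a) = Polynomial.monomial m.degree (monomial m a) := by
  rw [scaleHom, aeval_monomial, ← Polynomial.C_mul_X_pow_eq_monomial, monomial_eq,
    Finsupp.degree_apply]
  simp only [mul_pow, map_mul, Finsupp.prod, Finset.prod_mul_distrib,
    Finset.prod_pow_eq_pow_sum, map_prod, map_pow, ← mul_assoc]
  rfl

lemma coeff_scaleHom (F : MvPolynomial σ R) (k : ℕ) :
    (scaleHom σ R F).coeff k = homogeneousComponent k F := by
  induction F using MvPolynomial.induction_on' with
  | monomial m a =>
    rw [scaleHom_monomial, Polynomial.coeff_monomial,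
      homogeneousComponent_of_mem (isHomogeneous_monomial a rfl)]
    simp only [eq_comm]
  | add p q hp hq => simp [hp, hq]

lemma isHomogeneous_of_homogeneousComponent_eq_zero {F : MvPolynomial σ R} {n : ℕ}
    (hc : ∀ k, k ≠ n → homogeneousComponent k F = 0) : F.IsHomogeneous n := by
  intro m hm
  by_contra hne
  have h1 := congrArg (coeff m) (hc _ hne)
  rw [coeff_homogeneousComponent, if_pos (by rw [Finsupp.degree_eq_weight_one]; rfl)] at h1
  exact hm h1

lemma isHomogeneous_of_scaleHom_eq_monomial {F G : MvPolynomial σ R} {n : ℕ}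
    (h : scaleHom σ R F = Polynomial.monomial n G) : F.IsHomogeneous n := by
  refine isHomogeneous_of_homogeneousComponent_eq_zero fun k hk => ?_
  rw [← coeff_scaleHom, h, Polynomial.coeff_monomial, if_neg hk.symm]

lemma scaleHom_of_isHomogeneous {F : MvPolynomial σ R} {n : ℕ} (h : F.IsHomogeneous n) :
    scaleHom σ R F = Polynomial.monomial n F := by
  ext1 k
  rw [coeff_scaleHom, Polynomial.coeff_monomial, homogeneousComponent_of_mem h]
  simp only [eq_comm]

/-- A factor of a nonzero homogeneous polynomial is homogeneous. -/
lemma exists_isHomogeneous_of_dvd [IsDomain R] {F G : MvPolynomial σ R} {n : ℕ}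
    (hG : G.IsHomogeneous n) (hG0 : G ≠ 0) (h : F ∣ G) : ∃ m, F.IsHomogeneous m := by
  obtain ⟨H, rfl⟩ := h
  have hs := scaleHom_of_isHomogeneous hG
  rw [map_mul] at hs
  have h0 : scaleHom σ R F * scaleHom σ R H ≠ 0 := by
    rw [hs]; simpa using hG0
  have hF0 := left_ne_zero_of_mul h0
  have hH0 := right_ne_zero_of_mul h0
  have h1 := Polynomial.natDegree_mul hF0 hH0
  have h2 := Polynomial.natTrailingDegree_mul hF0 hH0
  rw [hs, Polynomial.natDegree_monomial_eq _ hG0] at h1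
  rw [hs, Polynomial.natTrailingDegree_monomial hG0] at h2
  have h3 := Polynomial.natTrailingDegree_le_natDegree (scaleHom σ R F)
  have h4 := Polynomial.natTrailingDegree_le_natDegree (scaleHom σ R H)
  -- Degrees and trailing degrees in `T` are both additive and both sum to `n`, so each factor is a
  -- monomial in `T`.
  have h5 : (scaleHom σ R F).natTrailingDegree = (scaleHom σ R F).natDegree := by omega
  refine ⟨(scaleHom σ R F).natDegree, isHomogeneous_of_scaleHom_eq_monomial
    (G := (scaleHom σ R F).leadingCoeff) ?_⟩
  ext1 k
  rw [Polynomial.coeff_monomial]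
  rcases lt_trichotomy k (scaleHom σ R F).natDegree with hk | hk | hk
  · rw [Polynomial.coeff_eq_zero_of_lt_natTrailingDegree (h5 ▸ hk), if_neg hk.ne']
  · rw [if_pos hk.symm, hk, Polynomial.leadingCoeff]
  · rw [Polynomial.coeff_eq_zero_of_natDegree_lt hk, if_neg hk.ne]

lemma aeval_mul_of_isHomogeneous {S : Type*} [CommRing S] [Algebra R S] {F : MvPolynomial σ R}
    {n : ℕ} (hF : F.IsHomogeneous n) (r : S) (x : σ → S) :
    aeval (fun i => r * x i) F = r ^ n * aeval x F := by
  have h : (aeval (R := R) fun i => r * x i).toRingHom = (Polynomial.evalRingHom r).comp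
      ((Polynomial.mapRingHom (aeval (R := R) x).toRingHom).comp (scaleHom σ R).toRingHom) := by
    apply MvPolynomial.ringHom_ext
    · intro a
      simp [scaleHom, MvPolynomial.algebraMap_eq]
    · intro i
      simp [scaleHom]; ring
  have h' := RingHom.congr_fun h F
  simp only [RingHom.comp_apply] at h'
  change aeval _ F = _ at h'
  rw [h']
  simp only [AlgHom.toRingHom_eq_coe, RingHom.coe_coe, scaleHom_of_isHomogeneous hF]
  simp [mul_comm]

end Homogeneous

/-! ### Translations and multiplicity -/

section Translate

variable {K : Type*} [Field K]

lemma eval_translate (A p : Fin 3 → K) (f : MvPolynomial (Fin 3) K) :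
    eval p (translate A f) = eval (p + A) f := by
  have h : (eval p).comp (aeval (R := K)
      (fun i => X i + C (A i) : Fin 3 → MvPolynomial (Fin 3) K)).toRingHom
      = eval (p + A) := by
    apply MvPolynomial.ringHom_ext
    · intro a; simp
    · intro i; simp
  exact RingHom.congr_fun h f

lemma aeval_translate {S : Type*} [CommRing S] [Algebra K S] (A : Fin 3 → K) (p : Fin 3 → S)
    (f : MvPolynomial (Fin 3) K) :
    aeval p (translate A f) = aeval (fun i => p i + algebraMap K S (A i)) f := by
  have h : (aeval (R := K) p).comp
      (aeval (R := K) (fun i => X i + C (A i) : Fin 3 → MvPolynomial (Fin 3) K))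
      = aeval (fun i => p i + algebraMap K S (A i)) := by
    apply MvPolynomial.algHom_ext
    intro i; simp
  exact AlgHom.congr_fun h f

lemma translate_translate (A B : Fin 3 → K) (f : MvPolynomial (Fin 3) K) :
    translate A (translate B f) = translate (A + B) f := by
  conv_lhs => rw [translate, aeval_translate]
  rw [translate]
  congr 2
  funext i
  simp [MvPolynomial.algebraMap_eq, add_assoc]

lemma translate_zero (f : MvPolynomial (Fin 3) K) : translate 0 f = f := by
  simp [translate]

lemma translate_ne_zero (A : Fin 3 → K) {f : MvPolynomial (Fin 3) K} (hf : f ≠ 0) :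
    translate A f ≠ 0 := by
  intro h
  apply hf
  rw [← translate_zero f, ← neg_add_cancel A, ← translate_translate, h, translate, map_zero]

lemma totalDegree_translate_le (A : Fin 3 → K) (f : MvPolynomial (Fin 3) K) :
    (translate A f).totalDegree ≤ f.totalDegree := by
  rw [translate, aeval_def, eval₂_eq]
  refine totalDegree_finsetSum_le fun m hm => ?_
  refine (totalDegree_mul _ _).trans ?_
  rw [MvPolynomial.algebraMap_eq, totalDegree_C, zero_add]
  refine (totalDegree_finsetProd _ _).trans ((Finset.sum_le_sum (g := fun i => m i) ?_).trans
    (le_totalDegree hm))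
  intro i _
  refine (totalDegree_pow _ _).trans ?_
  have : (X i + C (A i) : MvPolynomial (Fin 3) K).totalDegree ≤ 1 :=
    (totalDegree_add _ _).trans (by simp)
  nlinarith

lemma totalDegree_translate (A : Fin 3 → K) (f : MvPolynomial (Fin 3) K) :
    (translate A f).totalDegree = f.totalDegree := by
  refine (totalDegree_translate_le A f).antisymm ?_
  conv_lhs => rw [← translate_zero f, ← neg_add_cancel A, ← translate_translate]
  exact totalDegree_translate_le _ _

/-- A point of multiplicity `deg f` is a point about which `f` is homogeneous. -/
lemma isHomogeneous_translate_of_mult_eq {A : Fin 3 → K} {f : MvPolynomial (Fin 3) K}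
    (h : mult A f = f.totalDegree) : (translate A f).IsHomogeneous f.totalDegree := by
  refine isHomogeneous_of_homogeneousComponent_eq_zero fun k hk => ?_
  rcases lt_or_gt_of_ne hk with hk | hk
  · by_contra h0
    exact absurd (Nat.sInf_le (s := {n | homogeneousComponent n (translate A f) ≠ 0}) h0)
      (by rw [not_le]; rw [← h] at hk; exact hk)
  · exact homogeneousComponent_eq_zero _ _ (by rwa [totalDegree_translate])

end Translate

/-! ### Cones with two vertices -/

section TwoVertices

variable {K : Type*} [Field K]

lemma eval_smul_of_isHomogeneous {F : MvPolynomial (Fin 3) K} {n : ℕ} (hF : F.IsHomogeneous n)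
    (r : K) (x : Fin 3 → K) : eval (r • x) F = r ^ n * eval x F := by
  have := aeval_mul_of_isHomogeneous hF r x
  rwa [← MvPolynomial.coe_aeval_eq_eval, RingHom.coe_coe]

/-- If `F` is homogeneous about `0` and about `v`, it is invariant under translation by
multiples of `v`. -/
lemma eval_add_smul_of_isHomogeneous [Infinite K] {F : MvPolynomial (Fin 3) K} {n : ℕ}
    {v : Fin 3 → K} (hF : F.IsHomogeneous n) (hv : (translate v F).IsHomogeneous n)
    (x : Fin 3 → K) (c : K) : eval (x + c • v) F = eval x F := by
  have key (x : Fin 3 → K) (c : K) (hc : c ≠ 1) : eval (x + c • v) F = eval x F := by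
    have hc' : 1 - c ≠ 0 := sub_ne_zero.mpr hc.symm
    -- Scaling about `0` by `(1 - c)⁻¹`, then about `v` by `1 - c`, is translation by `c • v`; the
    -- two factors cancel.
    have h1 := eval_smul_of_isHomogeneous hv (1 - c) ((1 - c)⁻¹ • x - v)
    rw [eval_translate, eval_translate, sub_add_cancel, eval_smul_of_isHomogeneous hF,
      inv_pow, mul_inv_cancel_left₀ (pow_ne_zero _ hc')] at h1
    rw [← h1]
    congr 2
    rw [smul_sub, smul_inv_smul₀ hc', sub_smul, one_smul]
    abel
  by_cases hc : c = 1
  · obtain ⟨a, ha⟩ := Set.Infinite.exists_notMem_finite (Set.infinite_univ (α := K))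
      (Set.toFinite {0, 1})
    simp only [Set.mem_insert_iff, Set.mem_singleton_iff, not_or] at ha
    rw [hc, show x + (1 : K) • v = (x + a • v) + (1 - a) • v by
      rw [add_assoc, ← add_smul, add_sub_cancel], key _ _ (by simpa using ha.2.1), key _ _ ha.2.2]
  · exact key x c hc

/-- A homogeneous polynomial of positive degree vanishes at some nonzero point of each plane. -/
lemma exists_eval_eq_zero_of_isHomogeneous [IsAlgClosed K] {F : MvPolynomial (Fin 3) K} {n : ℕ}
    (hn : n ≠ 0) (hF : F.IsHomogeneous n) (e e' : Fin 3 → K) :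
    eval e' F = 0 ∨ ∃ t : K, eval (e + t • e') F = 0 := by
  by_contra! h
  obtain ⟨h0, h1⟩ := h
  -- `P` and `P'` restrict `F` to two affine lines in the span of `e, e'`, with `P'(t) = tⁿ P(1/t)`
  -- for `t ≠ 0`. A rootless `P` is constant, so `P' = c Xⁿ` vanishes at `0`, where its value is
  -- `F(e') ≠ 0`.
  let P : Polynomial K :=
    aeval (fun i => Polynomial.C (e i) + Polynomial.C (e' i) * Polynomial.X) F
  let P' : Polynomial K :=
    aeval (fun i => Polynomial.C (e i) * Polynomial.X + Polynomial.C (e' i)) F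
  have hP (t : K) : P.eval t = eval (e + t • e') F := by
    have h : (Polynomial.aeval t).comp
        (aeval (R := K) (fun i => Polynomial.C (e i) + Polynomial.C (e' i) * Polynomial.X))
        = aeval (e + t • e') := by
      apply MvPolynomial.algHom_ext
      intro i
      simp; ring
    have := AlgHom.congr_fun h F
    simpa [MvPolynomial.aeval_eq_eval] using this
  have hP' (t : K) : P'.eval t = eval (t • e + e') F := by
    have h : (Polynomial.aeval t).comp
        (aeval (R := K) (fun i => Polynomial.C (e i) * Polynomial.X + Polynomial.C (e' i)))
        = aeval (t • e + e') := by
      apply MvPolynomial.algHom_ext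
      intro i
      simp; ring
    have := AlgHom.congr_fun h F
    simpa [MvPolynomial.aeval_eq_eval] using this
  have hdeg : P.degree = 0 := by
    by_contra hd
    obtain ⟨t, ht⟩ := IsAlgClosed.exists_root P hd
    exact h1 t (by rw [← hP]; exact ht)
  obtain ⟨c, hc⟩ : ∃ c, P = Polynomial.C c := ⟨_, Polynomial.eq_C_of_degree_eq_zero hdeg⟩
  have hPP : P' = Polynomial.C c * Polynomial.X ^ n := by
    have : Set.Infinite {t : K | t ≠ 0} := by
      have := (Set.finite_singleton (0 : K)).infinite_compl
      exact this
    refine Polynomial.eq_of_infinite_eval_eq _ _ (this.mono fun t ht => ?_)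
    simp only [Set.mem_ofPred_eq] at ht ⊢
    rw [hP', show t • e + e' = t • (e + t⁻¹ • e') by rw [smul_add, smul_inv_smul₀ ht],
      eval_smul_of_isHomogeneous hF, ← hP, hc]
    simp only [Polynomial.eval_C, Polynomial.eval_mul, Polynomial.eval_pow, Polynomial.eval_X]
    ring
  apply h0
  have := hP' 0
  simpa [hPP, hn] using this.symm

/-- The triple product is a determinant, so its vanishing gives a linear relation among `x, q, v`;
independence of `q, v` makes the coefficient of `x` nonzero. -/
lemma dotProduct_eq_zero_imp_mem_span {q v x : Fin 3 → K}
    (h : LinearIndependent K ![q, v]) (hx : x ⬝ᵥ crossProduct q v = 0) :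
    ∃ a b : K, x = a • q + b • v := by
  rw [triple_product_eq_det] at hx
  obtain ⟨w, hw, hw0⟩ := Matrix.exists_vecMul_eq_zero_iff.mpr hx
  have hw1 : w 0 • x + w 1 • q + w 2 • v = 0 := by
    rw [← hw0]
    funext i
    simp [Matrix.vecMul, dotProduct, Fin.sum_univ_three]
  have h0 : w 0 ≠ 0 := by
    intro h0
    rw [h0, zero_smul, zero_add] at hw1
    obtain ⟨h1, h2⟩ := LinearIndependent.pair_iff.mp h _ _ hw1
    apply hw
    funext i
    fin_cases i <;> assumption
  refine ⟨-(w 0)⁻¹ * w 1, -(w 0)⁻¹ * w 2, ?_⟩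
  have : x = (w 0)⁻¹ • (w 0 • x) := by rw [inv_smul_smul₀ h0]
  rw [this, show w 0 • x = -(w 1 • q + w 2 • v) by
    rw [eq_neg_iff_add_eq_zero, ← add_assoc, hw1]]
  simp only [smul_neg, smul_add, smul_smul, neg_mul, neg_smul]
  abel

/-- A homogeneous polynomial of positive degree that is invariant under translation by
multiples of `v ≠ 0` vanishes on a plane through the origin. -/
lemma exists_plane_of_invariant [IsAlgClosed K] {F : MvPolynomial (Fin 3) K} {n : ℕ}
    (hn : n ≠ 0) (hF : F.IsHomogeneous n) {v : Fin 3 → K} (hv : v ≠ 0)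
    (hinv : ∀ x (c : K), eval (x + c • v) F = eval x F) :
    ∃ m : Fin 3 → K, m ≠ 0 ∧ ∀ x, x ⬝ᵥ m = 0 → eval x F = 0 := by
  obtain ⟨i, hi⟩ := Function.ne_iff.mp hv
  have hi1 : i + 1 ≠ i := by fin_cases i <;> decide
  have hi2 : i + 2 ≠ i := by fin_cases i <;> decide
  have hi3 : i + 1 ≠ i + 2 := by fin_cases i <;> decide
  -- The coordinate plane `xᵢ = 0` does not contain `v`, so a nonzero zero `q` of `F` in it is
  -- independent of `v`.
  obtain ⟨q, hq0, hqi, hq⟩ : ∃ q : Fin 3 → K, q ≠ 0 ∧ q i = 0 ∧ eval q F = 0 := by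
    rcases exists_eval_eq_zero_of_isHomogeneous hn hF (Pi.single (i + 1) 1) (Pi.single (i + 2) 1)
      with h | ⟨t, h⟩
    · exact ⟨_, by simp, by simp [hi2.symm], h⟩
    · refine ⟨_, ?_, ?_, h⟩
      · intro h0
        have := congrFun h0 (i + 1)
        simp [hi3] at this
      · simp [hi1.symm, hi2.symm]
  have hli : LinearIndependent K ![q, v] := by
    rw [LinearIndependent.pair_iff]
    intro a b hab
    have h1 := congrFun hab i
    simp only [Pi.add_apply, Pi.smul_apply, hqi, Pi.zero_apply, smul_eq_mul, mul_zero, zero_add,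
      mul_eq_zero] at h1
    have hb : b = 0 := h1.resolve_right hi
    rw [hb, zero_smul, add_zero, smul_eq_zero] at hab
    exact ⟨hab.resolve_right hq0, hb⟩
  refine ⟨crossProduct q v, crossProduct_ne_zero_iff_linearIndependent.mpr hli, fun x hx => ?_⟩
  obtain ⟨a, b, rfl⟩ := dotProduct_eq_zero_imp_mem_span hli hx
  rw [hinv, eval_smul_of_isHomogeneous hF, hq, mul_zero]

/-- An irreducible surface that contains a plane is that plane. -/
lemma isPlane_of_forall_eval_eq_zero [IsAlgClosed K] {f : MvPolynomial (Fin 3) K}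
    (hf : Irreducible f) {m A : Fin 3 → K} (hm : m ≠ 0)
    (h : ∀ x, (x - A) ⬝ᵥ m = 0 → eval x f = 0) : IsPlane (zeroSet f) := by
  let l : MvPolynomial (Fin 3) K := C (m 0) * X 0 + C (m 1) * X 1 + C (m 2) * X 2 - C (A ⬝ᵥ m)
  have hl (x : Fin 3 → K) : eval x l = (x - A) ⬝ᵥ m := by
    simp [l, dotProduct, Fin.sum_univ_three]; ring
  -- By the Nullstellensatz `l` divides a power of the prime `f`, so `l` is associated to some `f ^
  -- j`; `j ≠ 0` because `l` vanishes at `A`.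
  have hmem : f ∈ (Ideal.span {l}).radical := by
    rw [← vanishingIdeal_zeroLocus_eq_radical (K := K), mem_vanishingIdeal_iff]
    intro x hx
    rw [mem_zeroLocus_iff] at hx
    have := hx l (Ideal.mem_span_singleton_self l)
    rw [MvPolynomial.aeval_eq_eval] at this ⊢
    exact h x (by rw [← hl]; exact this)
  obtain ⟨k, hk⟩ := hmem
  rw [Ideal.mem_span_singleton] at hk
  obtain ⟨j, -, hj⟩ := (dvd_prime_pow hf.prime k).mp hk
  have hj0 : j ≠ 0 := by
    rintro rfl
    rw [pow_zero, associated_one_iff_isUnit] at hj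
    have := hj.map (eval A)
    rw [hl, sub_self, zero_dotProduct] at this
    exact not_isUnit_zero this
  have hfl : f ∣ l := (dvd_pow_self f hj0).trans hj.symm.dvd
  refine ⟨m, A ⬝ᵥ m, hm, ?_⟩
  ext x
  have hx : m 0 * x 0 + m 1 * x 1 + m 2 * x 2 = A ⬝ᵥ m ↔ (x - A) ⬝ᵥ m = 0 := by
    rw [sub_dotProduct, sub_eq_zero]
    simp [dotProduct, Fin.sum_univ_three, mul_comm]
  rw [Set.mem_ofPred_eq, hx]
  refine ⟨fun hx => ?_, h x⟩
  obtain ⟨r, hr⟩ := hfl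
  rw [← hl, hr, map_mul, show eval x f = 0 from hx, zero_mul]

/-- An irreducible cone with two vertices is a plane. -/
theorem isPlane_of_isHomogeneous_translate [IsAlgClosed K] {f : MvPolynomial (Fin 3) K}
    (hf : Irreducible f) {A B : Fin 3 → K} (hA : (translate A f).IsHomogeneous f.totalDegree)
    (hB : (translate B f).IsHomogeneous f.totalDegree) (hAB : A ≠ B) : IsPlane (zeroSet f) := by
  have hn : f.totalDegree ≠ 0 := by
    intro h0
    rw [totalDegree_eq_zero_iff_eq_C] at h0
    have hc : coeff 0 f ≠ 0 := by
      intro hc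
      rw [hc, C_0] at h0
      exact hf.ne_zero h0
    exact hf.not_isUnit (h0 ▸ (IsUnit.mk0 _ hc).map C)
  have hv : B - A ≠ 0 := sub_ne_zero.mpr hAB.symm
  have hB' : (translate (B - A) (translate A f)).IsHomogeneous f.totalDegree := by
    rwa [translate_translate, sub_add_cancel]
  have : Infinite K := IsAlgClosed.instInfinite
  obtain ⟨m, hm, h⟩ := exists_plane_of_invariant hn hA hv (eval_add_smul_of_isHomogeneous hA hB')
  refine isPlane_of_forall_eval_eq_zero hf (A := A) hm fun x hx => ?_
  rw [← h _ hx, eval_translate, sub_add_cancel]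

end TwoVertices

/-! ### Homogenization -/

section Homogenize

variable {K : Type*} [Field K]

/-- The homogenization of `F(y, z)` with respect to the variable `X 0`. -/
noncomputable def homogenize (F : MvPolynomial (Fin 2) K) : MvPolynomial (Fin 3) K :=
  ∑ k ∈ Finset.range (F.totalDegree + 1),
    X 0 ^ (F.totalDegree - k) * rename Fin.succ (homogeneousComponent k F)

lemma isHomogeneous_homogenize (F : MvPolynomial (Fin 2) K) :
    (homogenize F).IsHomogeneous F.totalDegree := by
  refine IsHomogeneous.sum _ _ _ fun k hk => ?_
  have h := (isHomogeneous_X_pow (R := K) (0 : Fin 3) (F.totalDegree - k)).mul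
    ((homogeneousComponent_isHomogeneous k F).rename_isHomogeneous (f := Fin.succ))
  rwa [Nat.sub_add_cancel (Nat.lt_succ_iff.mp (Finset.mem_range.mp hk))] at h

lemma aeval_homogenize {S : Type*} [CommRing S] [Algebra K S] (F : MvPolynomial (Fin 2) K)
    (x : Fin 3 → S) (y : Fin 2 → S) (hxy : ∀ i, x i.succ = x 0 * y i) :
    aeval x (homogenize F) = x 0 ^ F.totalDegree * aeval y F := by
  have hF : aeval y F = ∑ k ∈ Finset.range (F.totalDegree + 1),
      aeval y (homogeneousComponent k F) := by
    rw [← map_sum, sum_homogeneousComponent]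
  rw [homogenize, map_sum, hF, Finset.mul_sum]
  refine Finset.sum_congr rfl fun k hk => ?_
  rw [map_mul, map_pow, aeval_X, aeval_rename,
    show x ∘ Fin.succ = fun i => x 0 * y i from funext hxy,
    aeval_mul_of_isHomogeneous (homogeneousComponent_isHomogeneous k F), ← mul_assoc, ← pow_add,
    Nat.sub_add_cancel (Nat.lt_succ_iff.mp (Finset.mem_range.mp hk))]

/-- Setting `X 0 = 1` recovers `F`. -/
lemma homogenize_ne_zero {F : MvPolynomial (Fin 2) K} (hF : F ≠ 0) : homogenize F ≠ 0 := by
  intro h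
  have := aeval_homogenize F (Fin.cons 1 X : Fin 3 → MvPolynomial (Fin 2) K) X (by simp)
  rw [h] at this
  simp only [map_zero, Fin.cons_zero, one_pow, one_mul, aeval_X_left, AlgHom.id_apply] at this
  exact hF this.symm

end Homogenize

/-! ### Relations on the parametrization and on the surface -/

section Parametrization

variable {K : Type*} [Field K]

/-- A polynomial relation between the components of `Q` holds at all points of the image. -/
lemma eval_eq_zero_of_mem_image {Q : Fin 3 → RatFun K} {P : MvPolynomial (Fin 3) K}
    (hP : aeval Q P = 0) {p : Fin 3 → K} (hp : p ∈ image Q) : eval p P = 0 := by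
  obtain ⟨u, hu⟩ := hp
  -- The local ring `O` at `u` contains every `Q i`. It embeds in `K(t, s)` by `φ` and evaluates at
  -- `u` by `ψ`, so a relation moves from `Q` to `p`.
  let M : Submonoid (MvPolynomial (Fin 2) K) := (nonZeroDivisors K).comap (eval u)
  have hM {d} : d ∈ M ↔ eval u d ≠ 0 := by simp [M]
  let O := Localization M
  have hφ (y : M) : IsUnit (algebraMap (MvPolynomial (Fin 2) K) (RatFun K) y) := by
    rw [isUnit_iff_ne_zero, Ne, IsFractionRing.to_map_eq_zero_iff]
    intro h
    exact hM.mp y.2 (by rw [h, map_zero])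
  let φ : O →+* RatFun K := IsLocalization.lift hφ
  have hψ (y : M) : IsUnit (eval u (y : MvPolynomial (Fin 2) K)) :=
    isUnit_iff_ne_zero.mpr (hM.mp y.2)
  let ψ : O →+* K := IsLocalization.lift hψ
  have hφi : Function.Injective φ := by
    rw [IsLocalization.lift_injective_iff]
    intro x y
    have hMle : M ≤ nonZeroDivisors _ := fun d hd =>
      mem_nonZeroDivisors_of_ne_zero (by rintro rfl; exact hM.mp hd (map_zero _))
    rw [(IsLocalization.injective O hMle).eq_iff, (IsFractionRing.injective _ (RatFun K)).eq_iff]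
  let q : Fin 3 → O := fun i => IsLocalization.mk' O
    (IsFractionRing.num (MvPolynomial (Fin 2) K) (Q i))
    (⟨IsFractionRing.den (MvPolynomial (Fin 2) K) (Q i), hM.mpr (hu i).1⟩ : M)
  have hφq (i : Fin 3) : φ (q i) = Q i := by
    refine (IsLocalization.lift_mk'_spec _ _ _ _).mpr ?_
    exact ((div_eq_iff (hφ ⟨_, hM.mpr (hu i).1⟩).ne_zero).mp
      (IsFractionRing.mk'_num_den' (A := MvPolynomial (Fin 2) K) (Q i))).trans (mul_comm _ _)
  have hψq (i : Fin 3) : ψ (q i) = p i := by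
    refine (IsLocalization.lift_mk'_spec _ _ _ _).mpr ?_
    exact ((div_eq_iff (hu i).1).mp (hu i).2.symm).trans (mul_comm _ _)
  let Ψ : MvPolynomial (Fin 3) K →+* O :=
    eval₂Hom ((algebraMap (MvPolynomial (Fin 2) K) O).comp C) q
  have h1 : φ.comp Ψ = (aeval Q).toRingHom := by
    apply MvPolynomial.ringHom_ext
    · intro a
      simp only [Ψ, φ, RingHom.comp_apply, eval₂Hom_C, IsLocalization.lift_eq]
      simp [IsScalarTower.algebraMap_apply K (MvPolynomial (Fin 2) K) (RatFun K),
        MvPolynomial.algebraMap_eq]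
    · intro i
      simpa [Ψ] using hφq i
  have h2 : ψ.comp Ψ = eval p := by
    apply MvPolynomial.ringHom_ext
    · intro a
      simp only [Ψ, ψ, RingHom.comp_apply, eval₂Hom_C, IsLocalization.lift_eq]
      simp
    · intro i
      simpa [Ψ] using hψq i
  have h3 : Ψ P = 0 := hφi (by
    rw [map_zero, ← RingHom.comp_apply, h1]
    exact hP)
  rw [← h2, RingHom.comp_apply, h3, map_zero]

/-- A relation on `Q` vanishes on the image, hence on its closure `Z`; the Nullstellensatz and
primality of `f` give divisibility. -/
lemma dvd_of_aeval_eq_zero [IsAlgClosed K] {Z : Set (Fin 3 → K)} {f P : MvPolynomial (Fin 3) K}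
    {Q : Fin 3 → RatFun K} (hf : IsDefiningPolynomial f Z) (hQ : IsParametrization Q Z)
    (hP : aeval Q P = 0) : f ∣ P := by
  have hZ : ∀ z ∈ Z, eval z P = 0 := by
    intro z hz
    rw [hQ, mem_zeroLocus_iff] at hz
    have := hz P (mem_vanishingIdeal_iff.mpr fun p hp => by
      rw [MvPolynomial.aeval_eq_eval]; exact eval_eq_zero_of_mem_image hP hp)
    rwa [MvPolynomial.aeval_eq_eval] at this
  have hmem : P ∈ (Ideal.span {f}).radical := by
    rw [← vanishingIdeal_zeroLocus_eq_radical (K := K), mem_vanishingIdeal_iff]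
    intro x hx
    rw [mem_zeroLocus_iff] at hx
    have := hx f (Ideal.mem_span_singleton_self f)
    rw [MvPolynomial.aeval_eq_eval] at this ⊢
    exact hZ x (by rw [hf.2]; exact this)
  obtain ⟨k, hk⟩ := hmem
  exact hf.1.prime.dvd_of_dvd_pow (Ideal.mem_span_singleton.mp hk)

/-- If the two components of `χ` are algebraically dependent, the surface is a cone. -/
lemma isHomogeneous_translate_of_aeval_chi_eq_zero [IsAlgClosed K] {Z : Set (Fin 3 → K)}
    {f : MvPolynomial (Fin 3) K} {Q : Fin 3 → RatFun K} (hf : IsDefiningPolynomial f Z)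
    (hQ : IsParametrization Q Z) {A : Fin 3 → K}
    (hA : Q 0 - algebraMap K (RatFun K) (A 0) ≠ 0)
    {F : MvPolynomial (Fin 2) K} (hF : F ≠ 0) (h : aeval (chi Q A) F = 0) :
    (translate A f).IsHomogeneous f.totalDegree := by
  -- Since `Q - A = (Q 0 - a) · (1, χ₁, χ₂)`, the homogenized relation vanishes at `Q - A`.
  have h1 : aeval Q (translate (-A) (homogenize F)) = 0 := by
    rw [aeval_translate, aeval_homogenize F _ (chi Q A), h, mul_zero]
    intro i
    simp only [Pi.neg_apply, map_neg, ← sub_eq_add_neg, chi]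
    fin_cases i <;> simp [mul_div_cancel₀ _ hA]
  obtain ⟨H, hH⟩ := dvd_of_aeval_eq_zero hf hQ h1
  have h2 : translate A f ∣ homogenize F := by
    refine ⟨translate A H, ?_⟩
    rw [← translate_zero (homogenize F), ← add_neg_cancel A, ← translate_translate, hH]
    simp [translate]
  obtain ⟨m, hm⟩ := exists_isHomogeneous_of_dvd (isHomogeneous_homogenize F)
    (homogenize_ne_zero hF) h2
  have := hm.totalDegree (translate_ne_zero A hf.1.ne_zero)
  rw [totalDegree_translate] at this
  rwa [this]

end Parametrization

/-! ### Exchange in the algebraic independence matroid -/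

section Exchange

variable {K L : Type*} [Field K] [Field L] [Algebra K L]

/-- If `c₀, c₁` are algebraically independent and algebraic over `K[t₀, t₁]`, then `t₀, t₁` are
algebraic over `K[c₀, c₁]`. -/
lemma closure_range_le_of_algebraicIndependent {ι : Type*} [Finite ι] {c t : ι → L}
    (hc : AlgebraicIndependent K c)
    (h : Set.range c ⊆ (AlgebraicIndependent.matroid K L).closure (Set.range t)) :
    Set.range t ⊆ (AlgebraicIndependent.matroid K L).closure (Set.range c) := by
  set M := AlgebraicIndependent.matroid K L
  have hI : M.Indep (Set.range c) := AlgebraicIndependent.matroid_indep_iff.mpr hc.to_subtype_range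
  -- The closure of `t` has rank at most the number of indices, which is exactly the rank of the
  -- independent family `c`; hence the two closures agree.
  have hr : M.eRk (M.closure (Set.range t)) ≤ M.eRk (Set.range c) := by
    rw [Matroid.eRk_closure_eq, hI.eRk_eq_encard]
    refine (M.eRk_le_encard _).trans ?_
    rw [← Set.image_univ, ← Set.image_univ, hc.injective.encard_image]
    exact Set.encard_image_le _ _
  rw [(M.isRkFinite_of_finite (Set.finite_range c)).closure_eq_closure_of_subset_of_eRk_ge_eRk h hr]
  rw [Matroid.closure_closure]
  exact M.subset_closure _ (Set.subset_univ _)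

lemma mem_closure_range_of_mul_eq {c : L} {t : Fin 2 → L} {n d : MvPolynomial (Fin 2) K}
    (hd : aeval t d ≠ 0) (h : c * aeval t d = aeval t n) :
    c ∈ (AlgebraicIndependent.matroid K L).closure (Set.range t) := by
  have hm (q : MvPolynomial (Fin 2) K) : IsAlgebraic (Algebra.adjoin K (Set.range t)) (aeval t q) :=
    isAlgebraic_algebraMap (⟨aeval t q, by
      rw [Algebra.adjoin_range_eq_range_aeval]; exact ⟨q, rfl⟩⟩ : Algebra.adjoin K (Set.range t))
  rw [AlgebraicIndependent.matroid_closure_eq, SetLike.mem_coe,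
    Subalgebra.mem_algebraicClosure, eq_div_of_mul_eq hd h, div_eq_mul_inv]
  exact (hm n).mul (hm d).inv

/-- Independence of `t` identifies `K[t]` with a polynomial ring, so the coefficients of an
algebraic equation for `x` lift. -/
lemma exists_polynomial_of_mem_closure {x : L} {t : Fin 2 → L} (ht : AlgebraicIndependent K t)
    (hx : x ∈ (AlgebraicIndependent.matroid K L).closure (Set.range t)) :
    ∃ P : Polynomial (MvPolynomial (Fin 2) K), P ≠ 0 ∧
      P.eval₂ (aeval t : MvPolynomial (Fin 2) K →ₐ[K] L).toRingHom x = 0 := by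
  rw [AlgebraicIndependent.matroid_closure_eq, SetLike.mem_coe,
    Subalgebra.mem_algebraicClosure] at hx
  obtain ⟨P, hP0, hP⟩ := hx
  let e := ht.aevalEquiv.symm.toRingEquiv
  refine ⟨P.map (e : _ →+* MvPolynomial (Fin 2) K), ?_, ?_⟩
  · rwa [Ne, Polynomial.map_eq_zero_iff e.injective]
  · rw [Polynomial.eval₂_map, ← hP, Polynomial.aeval_def]
    congr 1
    ext y
    obtain ⟨q, rfl⟩ := ht.aevalEquiv.surjective y
    simp [e, ht.algebraMap_aevalEquiv]

end Exchange

/-! ### Divisibility in `K[h₁, h₂][t, s]` -/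

section Coprime

variable {K : Type*} [Field K]

lemma not_dvd_C_of_totalDegree_pos {p : PolyTSH K} (hp : p.totalDegree ≠ 0)
    {q : MvPolynomial (Fin 2) K} (hq : q ≠ 0) : ¬ p ∣ C q := by
  intro h
  have := totalDegree_le_of_dvd_of_isDomain h (by simpa using hq)
  rw [totalDegree_C] at this
  omega

/-- After swapping the two sets of variables, `d` becomes a constant, so its divisor `p` is a
constant too, and it divides the coprime `n` and `d`. -/
lemma not_dvd_map_C_of_isRelPrime {p : PolyTSH K} (hp : ¬ IsUnit p)
    {n d : MvPolynomial (Fin 2) K} (hd : d ≠ 0) (hnd : IsRelPrime n d)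
    (hpn : p ∣ MvPolynomial.map C n) (hpd : p ∣ MvPolynomial.map C d) : False := by
  let e := commAlgEquiv K (Fin 2) (Fin 2)
  have he (q : MvPolynomial (Fin 2) K) (h : p ∣ MvPolynomial.map C q) : e.symm p ∣ C q := by
    have := map_dvd e.symm h
    rwa [← commAlgEquiv_C, AlgEquiv.symm_apply_apply] at this
  obtain ⟨b, -, hb⟩ := (dvd_C_iff_exists hd).mp (he d hpd)
  have hbd : b ∣ d := by
    have := (C_dvd_iff_dvd_coeff _ _).mp (hb ▸ he d hpd) 0
    simpa using this
  have hbn : b ∣ n := by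
    have := (C_dvd_iff_dvd_coeff _ _).mp (hb ▸ he n hpn) 0
    simpa using this
  have hu : IsUnit (e.symm p) := hb ▸ (hnd hbn hbd).map C
  apply hp
  have := hu.map e
  rwa [AlgEquiv.apply_symm_apply] at this

lemma exists_prime_dvd_totalDegree_ne_zero {q : PolyTSH K} (hq : q.totalDegree ≠ 0) :
    ∃ p, Prime p ∧ p ∣ q ∧ p.totalDegree ≠ 0 := by
  revert hq
  refine UniqueFactorizationMonoid.induction_on_prime q ?_ ?_ ?_
  · simp
  · intro x hx h
    exact absurd (isUnit_iff_totalDegree_of_isReduced.mp hx).2 h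
  · intro a p ha hp ih h
    by_cases hp0 : p.totalDegree = 0
    · rw [totalDegree_mul_of_isDomain hp.ne_zero ha, hp0, zero_add] at h
      obtain ⟨p', h1, h2, h3⟩ := ih h
      exact ⟨p', h1, h2.mul_left p, h3⟩
    · exact ⟨p, hp, dvd_mul_right p a, hp0⟩

lemma num_dvd_of_mul_eq {R F : Type*} [CommRing R] [IsDomain R] [UniqueFactorizationMonoid R]
    [Field F] [Algebra R F] [IsFractionRing R F] {x : F} {a b : R}
    (h : x * algebraMap R F b = algebraMap R F a) : IsFractionRing.num R x ∣ a := by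
  have hd : algebraMap R F (IsFractionRing.den R x) ≠ 0 := by
    rw [Ne, IsFractionRing.to_map_eq_zero_iff]
    exact nonZeroDivisors.ne_zero (IsFractionRing.den R x).2
  have h1 : IsFractionRing.num R x * b = a * IsFractionRing.den R x := by
    apply IsFractionRing.injective R F
    rw [map_mul, map_mul, ← h, mul_right_comm, (div_eq_iff hd).mp (IsFractionRing.mk'_num_den' R x)]
  exact (IsFractionRing.num_den_reduced R x).dvd_of_dvd_mul_right (h1 ▸ dvd_mul_right _ _)

end Coprime

/-! ### A common factor makes `χ₁, χ₂` dependent -/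

section Dependence

variable {K : Type*} [Field K]

/-- The right-hand side is the numerator before cancellation, over the common denominator `d(t, s)
d(h₁, h₂)`. -/
lemma gPart_dvd (Q : Fin 3 → RatFun K) (A : Fin 3 → K) (i : Fin 2) :
    gPart Q A i ∣
      MvPolynomial.map C (IsFractionRing.num (MvPolynomial (Fin 2) K) (chi Q A i)) *
        C (IsFractionRing.den (MvPolynomial (Fin 2) K) (chi Q A i) : MvPolynomial (Fin 2) K) -
      C (IsFractionRing.num (MvPolynomial (Fin 2) K) (chi Q A i)) *
        MvPolynomial.map C
          (IsFractionRing.den (MvPolynomial (Fin 2) K) (chi Q A i) : MvPolynomial (Fin 2) K) := by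
  set x := chi Q A i
  set n := IsFractionRing.num (MvPolynomial (Fin 2) K) x
  set d := (IsFractionRing.den (MvPolynomial (Fin 2) K) x).1
  have hd : d ≠ 0 := nonZeroDivisors.ne_zero (IsFractionRing.den _ x).2
  have hx : x * algebraMap _ (RatFun K) d = algebraMap _ (RatFun K) n := by
    refine ((div_eq_iff ?_).mp (IsFractionRing.mk'_num_den' _ x)).symm
    rwa [Ne, IsFractionRing.to_map_eq_zero_iff]
  have hT (q : MvPolynomial (Fin 2) K) : inTS K (algebraMap _ (RatFun K) q) =
      algebraMap (PolyTSH K) (FractionRing (PolyTSH K)) (MvPolynomial.map C q) := by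
    simp [inTS, IsFractionRing.map]
  have hH (q : MvPolynomial (Fin 2) K) : inH K (algebraMap _ (RatFun K) q) =
      algebraMap (PolyTSH K) (FractionRing (PolyTSH K)) (C q) := by
    simp [inH, IsFractionRing.map]
  have hxT := congrArg (inTS K) hx
  have hxH := congrArg (inH K) hx
  rw [map_mul, hT, hT] at hxT
  rw [map_mul, hH, hH] at hxH
  refine num_dvd_of_mul_eq (F := FractionRing (PolyTSH K)) (b := MvPolynomial.map C d * C d) ?_
  rw [map_sub, map_mul, map_mul, map_mul, ← hxT, ← hxH]
  ring

/-- The residue field of a prime element. -/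
lemma exists_algHom_field_of_prime.{u, v} (K : Type u) {R : Type v} [Field K] [CommRing R]
    [Algebra K R] {p : R} (hp : Prime p) :
    ∃ (L : Type v) (_ : Field L) (_ : Algebra K L) (π : R →ₐ[K] L), ∀ {q}, π q = 0 ↔ p ∣ q := by
  have : (Ideal.span {p}).IsPrime := (Ideal.span_singleton_prime hp.ne_zero).mpr hp
  refine ⟨FractionRing (R ⧸ Ideal.span {p}), inferInstance, inferInstance,
    (IsScalarTower.toAlgHom K (R ⧸ Ideal.span {p}) (FractionRing (R ⧸ Ideal.span {p}))).comp
      (Ideal.Quotient.mkₐ K _), fun {q} => ?_⟩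
  rw [AlgHom.comp_apply, IsScalarTower.toAlgHom_apply, IsFractionRing.to_map_eq_zero_iff,
    Ideal.Quotient.mkₐ_eq_mk, Ideal.Quotient.eq_zero_iff_mem, Ideal.mem_span_singleton]

/-- If a prime of positive degree in `t, s` divides both `gᵢ`, the components of `χ` are
algebraically dependent. -/
lemma not_algebraicIndependent_chi {Q : Fin 3 → RatFun K} {A : Fin 3 → K} {p : PolyTSH K}
    (hp : Prime p) (hp0 : p.totalDegree ≠ 0) (hpg : ∀ i, p ∣ gPart Q A i) :
    ¬ AlgebraicIndependent K (chi Q A) := by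
  intro hχ
  obtain ⟨L, _, _, π, hπ⟩ := exists_algHom_field_of_prime K hp
  let t : Fin 2 → L := fun i => π (X i)
  let h : Fin 2 → L := fun i => π (C (X i))
  have htq (q : MvPolynomial (Fin 2) K) : aeval t q = π (MvPolynomial.map C q) := by
    have : (aeval t : MvPolynomial (Fin 2) K →ₐ[K] L).toRingHom
        = π.toRingHom.comp (MvPolynomial.map C) := by
      apply MvPolynomial.ringHom_ext
      · intro a
        simpa [MvPolynomial.algebraMap_eq] using (π.commutes a).symm
      · intro i
        simp [t]
    exact RingHom.congr_fun this q
  have hhq (q : MvPolynomial (Fin 2) K) : aeval h q = π (C q) := by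
    have : (aeval h : MvPolynomial (Fin 2) K →ₐ[K] L).toRingHom = π.toRingHom.comp C := by
      apply MvPolynomial.ringHom_ext
      · intro a
        simpa [MvPolynomial.algebraMap_eq] using (π.commutes a).symm
      · intro i
        simp [h]
    exact RingHom.congr_fun this q
  -- As `p` has positive degree in `t, s`, it divides no nonzero polynomial in `h₁, h₂` alone; hence
  -- `χ(h)` makes sense in `L`.
  have hh : AlgebraicIndependent K h := by
    rw [algebraicIndependent_iff]
    intro q hq
    by_contra hq0
    rw [hhq, hπ] at hq
    exact not_dvd_C_of_totalDegree_pos hp0 hq0 hq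
  let β : RatFun K →ₐ[K] L :=
    (IsFractionRing.liftAlgHom (A := MvPolynomial (Fin 2) K) (g := aeval h) hh)
  have hβ (q : MvPolynomial (Fin 2) K) : β (algebraMap _ (RatFun K) q) = aeval h q := by
    exact IsFractionRing.lift_algebraMap hh q
  let c : Fin 2 → L := fun i => β (chi Q A i)
  have hc : AlgebraicIndependent K c := hχ.map' β.injective
  have hcd (i : Fin 2) : ∃ n d : MvPolynomial (Fin 2) K, aeval h d ≠ 0 ∧ aeval t d ≠ 0 ∧
      c i * aeval h d = aeval h n ∧ c i * aeval t d = aeval t n := by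
    have hg := (hpg i).trans (gPart_dvd Q A i)
    have hnd := IsFractionRing.num_den_reduced (MvPolynomial (Fin 2) K) (chi Q A i)
    have hd : (IsFractionRing.den (MvPolynomial (Fin 2) K) (chi Q A i) : MvPolynomial (Fin 2) K)
      ≠ 0 := nonZeroDivisors.ne_zero (IsFractionRing.den _ _).2
    have hx := (div_eq_iff (by rwa [Ne, IsFractionRing.to_map_eq_zero_iff])).mp
      (IsFractionRing.mk'_num_den' (MvPolynomial (Fin 2) K) (chi Q A i))
    generalize IsFractionRing.num (MvPolynomial (Fin 2) K) (chi Q A i) = n at *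
    generalize (IsFractionRing.den (MvPolynomial (Fin 2) K) (chi Q A i) :
      MvPolynomial (Fin 2) K) = d at *
    have hhd : aeval h d ≠ 0 := by
      rw [hhq, Ne, hπ]
      exact not_dvd_C_of_totalDegree_pos hp0 hd
    have hc1 : c i * aeval h d = aeval h n := by
      rw [← hβ, ← hβ, hx, map_mul]
    have hrel : aeval t n * aeval h d = aeval h n * aeval t d := by
      rw [← sub_eq_zero, htq, htq, hhq, hhq, ← map_mul, ← map_mul, ← map_sub, hπ]
      exact hg
    -- If `d(t)` vanished in `L`, so would `n(t)`, and `p` would divide both, against coprimality.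
    have htd : aeval t d ≠ 0 := by
      intro h0
      rw [h0, mul_zero] at hrel
      have h1 := (mul_eq_zero.mp hrel).resolve_right hhd
      rw [htq, hπ] at h0 h1
      exact not_dvd_map_C_of_isRelPrime hp.not_isUnit hd hnd h1 h0
    refine ⟨n, d, hhd, htd, hc1, mul_right_cancel₀ hhd ?_⟩
    rw [hrel, ← hc1]
    ring
  set M := AlgebraicIndependent.matroid K L
  have hct : Set.range c ⊆ M.closure (Set.range t) := by
    rintro _ ⟨i, rfl⟩
    obtain ⟨n, d, -, h2, -, h4⟩ := hcd i
    exact mem_closure_range_of_mul_eq h2 h4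
  have hch : Set.range c ⊆ M.closure (Set.range h) := by
    rintro _ ⟨i, rfl⟩
    obtain ⟨n, d, h1, -, h3, -⟩ := hcd i
    exact mem_closure_range_of_mul_eq h1 h3
  have hth : Set.range t ⊆ M.closure (Set.range h) :=
    (closure_range_le_of_algebraicIndependent hc hct).trans
      (M.closure_subset_closure_of_subset_closure hch)
  -- Algebraicity of the `j`-th coordinate of `t` over `K(h)` makes `p` divide a nonzero polynomial
  -- in `X j` and `h` only, so `X k` does not occur in `p`.
  have hdeg (j k : Fin 2) (hjk : j ≠ k) : p.degreeOf k = 0 := by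
    obtain ⟨P, hP0, hP⟩ := exists_polynomial_of_mem_closure hh (hth ⟨j, rfl⟩)
    have hdvd : p ∣ Polynomial.aeval (X j) P := by
      rw [← hπ, ← hP, Polynomial.aeval_def]
      change π.toRingHom _ = _
      rw [Polynomial.hom_eval₂]
      congr 1
      exact RingHom.ext fun q => (hhq q).symm
    have hne : (Polynomial.aeval (X j) P : PolyTSH K) ≠ 0 := fun h0 =>
      hP0 ((transcendental_iff.mp (transcendental_X _ j)) P h0)
    have hz : (Polynomial.aeval (X j) P : PolyTSH K).degreeOf k = 0 := by
      rw [← Nat.le_zero, Polynomial.aeval_eq_sum_range]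
      refine (degreeOf_sum_le _ _ _).trans (Finset.sup_le fun m _ => ?_)
      rw [smul_eq_C_mul]
      refine (degreeOf_C_mul_le _ _ _).trans ?_
      rw [degreeOf_pow_eq _ _ _ (X_ne_zero j), degreeOf_X_of_ne hjk.symm, mul_zero]
    obtain ⟨r, hr⟩ := hdvd
    rw [hr, degreeOf_mul_eq hp.ne_zero (right_ne_zero_of_mul (hr ▸ hne))] at hz
    omega
  apply hp0
  rw [← Nat.le_zero]
  refine Finset.sup_le fun m hm => ?_
  have h0 := (monomial_le_degreeOf 0 hm).trans (hdeg 1 0 (by decide)).le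
  have h1 := (monomial_le_degreeOf 1 hm).trans (hdeg 0 1 (by decide)).le
  rw [Finsupp.sum_fintype _ _ (fun _ => rfl), Fin.sum_univ_two]
  omega

end Dependence

/-! ### Points with `g ≠ 1` are vertices -/

/-- If `Q 0` is the constant `a`, division by zero makes both `χᵢ` zero, so the gcd is `0`, of total
degree `0`, and `g` takes its default value `1`. -/
lemma sub_ne_zero_of_g_ne_one {K : Type*} [Field K] {Q : Fin 3 → RatFun K} {A : Fin 3 → K}
    (h : g Q A ≠ 1) : Q 0 - algebraMap K (RatFun K) (A 0) ≠ 0 := by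
  intro h0
  apply h
  have hg (i : Fin 2) : gPart Q A i = 0 := by
    have : chi Q A i = 0 := by fin_cases i <;> simp [chi, h0]
    rw [gPart, this, map_zero, map_zero, sub_zero, IsFractionRing.num_zero]
  have h0 : polyGCD (gPart Q A 0) (gPart Q A 1) = 0 := by
    let := UniqueFactorizationMonoid.toGCDMonoid (PolyTSH K)
    rw [hg, hg]
    exact zero_dvd_iff.mp (dvd_gcd dvd_rfl dvd_rfl)
  rw [g, h0, totalDegree_zero, if_neg (lt_irrefl 0)]

/-- A point with `g ≠ 1` is a vertex: the surface is a cone about it. -/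
theorem isHomogeneous_translate_of_g_ne_one {K : Type*} [Field K] [IsAlgClosed K]
    {Z : Set (Fin 3 → K)} {f : MvPolynomial (Fin 3) K} {Q : Fin 3 → RatFun K}
    (hf : IsDefiningPolynomial f Z) (hQ : IsParametrization Q Z) {A : Fin 3 → K}
    (h : g Q A ≠ 1) : (translate A f).IsHomogeneous f.totalDegree := by
  have hdeg : (polyGCD (gPart Q A 0) (gPart Q A 1)).totalDegree ≠ 0 := by
    intro h0
    exact h (by rw [g, if_neg (by omega)])
  obtain ⟨p, hp, hpd, hp0⟩ := exists_prime_dvd_totalDegree_ne_zero hdeg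
  have hpg : ∀ i, p ∣ gPart Q A i := by
    let := UniqueFactorizationMonoid.toGCDMonoid (PolyTSH K)
    rw [Fin.forall_fin_two]
    exact ⟨hpd.trans (gcd_dvd_left _ _), hpd.trans (gcd_dvd_right _ _)⟩
  have hdep := not_algebraicIndependent_chi hp hp0 hpg
  rw [algebraicIndependent_iff] at hdep
  push Not at hdep
  obtain ⟨F, hF, hF0⟩ := hdep
  exact isHomogeneous_translate_of_aeval_chi_eq_zero hf hQ (sub_ne_zero_of_g_ne_one h) hF0 hF

end RationalSurface

theorem mainTheorem5 {K : Type*} [Field K] [IsAlgClosed K] [CharZero K]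
    (Z : Set (Fin 3 → K)) (f : MvPolynomial (Fin 3) K)
    (hf : RationalSurface.IsDefiningPolynomial f Z)
    (Q : Fin 3 → RationalSurface.RatFun K) (hQ : RationalSurface.IsParametrization Q Z)
    (hZ : ¬ RationalSurface.IsPlane Z) :
    (∀ A B : Fin 3 → K,
      RationalSurface.g Q A ≠ 1 → RationalSurface.g Q B ≠ 1 → A = B) ∧
    (∀ A B : Fin 3 → K,
      RationalSurface.mult A f = f.totalDegree →
      RationalSurface.mult B f = f.totalDegree → A = B) := by
  have key {A B : Fin 3 → K}
      (hA : (RationalSurface.translate A f).IsHomogeneous f.totalDegree)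
      (hB : (RationalSurface.translate B f).IsHomogeneous f.totalDegree) : A = B := by
    by_contra hAB
    exact hZ (hf.2 ▸ RationalSurface.isPlane_of_isHomogeneous_translate hf.1 hA hB hAB)
  exact ⟨fun A B hA hB => key (RationalSurface.isHomogeneous_translate_of_g_ne_one hf hQ hA)
      (RationalSurface.isHomogeneous_translate_of_g_ne_one hf hQ hB),
    fun A B hA hB => key (RationalSurface.isHomogeneous_translate_of_mult_eq hA)
      (RationalSurface.isHomogeneous_translate_of_mult_eq hB)⟩
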